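/- Let $(S,\mathfrak m,k)$ and $(T,\mathfrak n,k)$ be commutative Noetherian local rings with a common residue field $k$, neither of which is a field, and let $\pi_S:S\twoheadrightarrow k$ and $\pi_T:T\twoheadrightarrow k$ be the natural surjections. Let $$R=S\times_k T=\{(s,t)\in S\times T \mid \pi_S(s)=\pi_T(t)\}$$ be their fiber product. Regard $S$-modules and $T$-modules as $R$-modules via the coordinate projections $R\to S$ and $R\to T$. Let $X$ and $Y$ be finitely generated $S$-modules, let $Z$ be a finitely generated $T$-module, and let $m\ge 0$ be an integer. Then: 1. If $\operatorname{Tor}^R_{2m+1}(X,Y)=0$, then $X=0$ or $Y=0$. 2. If $\operatorname{Tor}^R_{2m}(Y,Z)=0$, then $Y=0$ or $Z=0$. 3. If $\operatorname{Tor}^R_{2m}(X,Y)=0$ and $X\neq 0$, then $Y$ is a free $S$-module. 4. If $T$ is not a discrete valuation ring and $\operatorname{Tor}^R_{2m}(X,Y)=0$, then $X=0$ or $Y=0$. 5. If $\operatorname{Tor}^R_{2m+1}(Y,Z)=0$ and $Y\neq 0$, then $Z$ is a free $T$-module. 6. If $S$ is not a discrete valuation ring, $m>0$ and $\operatorname{Tor}^R_{2m+1}(Y,Z)=0$,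 then $Y=0$ or $Z=0$. The corresponding statements, with the roles of $S$ and $T$ interchanged, hold when $X$ and $Y$ are finitely generated $T$-modules and $Z$ is a finitely generated $S$-module. -/

import Mathlib

open CategoryTheory

universe u v

noncomputable section

namespace FiberTor

section Ring

variable {S T : Type u} {k : Type v} [CommRing S] [CommRing T] [Field k]

/-- The fiber product `S ×_k T = {(s, t) ∈ S × T | πS s = πT t}`, a subring of `S × T`. -/
abbrev fiberProduct (πS : S →+* k) (πT : T →+* k) : Subring (S × T) :=
  (πS.comp (RingHom.fst S T)).eqLocus (πT.comp (RingHom.snd S T))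

/-- The projection `S ×_k T → S`, `(s, t) ↦ s`. -/
abbrev etaS (πS : S →+* k) (πT : T →+* k) : fiberProduct πS πT →+* S :=
  (RingHom.fst S T).comp (fiberProduct πS πT).subtype

/-- The projection `S ×_k T → T`, `(s, t) ↦ t`. -/
abbrev etaT (πS : S →+* k) (πT : T →+* k) : fiberProduct πS πT →+* T :=
  (RingHom.snd S T).comp (fiberProduct πS πT).subtype

/-- An `S`-module regarded as a module over `S ×_k T` along the projection to `S`. -/
abbrev ofS (πS : S →+* k) (πT : T →+* k) (X : Type u) [AddCommGroup X] [Module S X] :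
    ModuleCat.{u} (fiberProduct πS πT) :=
  (ModuleCat.restrictScalars (etaS πS πT)).obj (ModuleCat.of S X)

/-- A `T`-module regarded as a module over `S ×_k T` along the projection to `T`. -/
abbrev ofT (πS : S →+* k) (πT : T →+* k) (Z : Type u) [AddCommGroup Z] [Module T Z] :
    ModuleCat.{u} (fiberProduct πS πT) :=
  (ModuleCat.restrictScalars (etaT πS πT)).obj (ModuleCat.of T Z)

end Ring

/-- `Tor_n^R(M, N) = 0`. -/
def TorVanishes {R : Type u} [CommRing R] (n : ℕ) (M N : ModuleCat.{u} R) : Prop :=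
  Limits.IsZero (((Tor (ModuleCat.{u} R) n).obj M).obj N)

/-- `A` is a discrete valuation ring; being an integral domain is part of the condition. -/
def IsDVR (A : Type u) [CommRing A] : Prop :=
  ∃ _ : IsDomain A, IsDiscreteValuationRing A

end FiberTor

end

/-! The ring `R` is Noetherian local, and its maximal ideal is `I ⊕ J`, where `I` and `J` are the
kernels of the two projections and `I * J = 0`. Let `Y` be a nonzero module killed by `I`. The
kernel of a minimal cover `R^n → Y` lies in `I^n ⊕ J^n` and contains `I^n`, so it equals `A ⊕ I^n`
with `A ⊆ J^n`. Here `A` is killed by `I`, while `I` is killed by `J`. Hence `Tor_{i+2}(M, Y) = 0`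
gives the vanishing of `Tor_{i+1}(M, A)` and of `Tor_{i+1}(M, I)` (`exists_syzygy`).

Passing to `I` changes sides and lowers the degree by one. Induction therefore reduces items 1 and 2
to degrees 0 and 1 (`subsingleton_or_of_tor`). Passing to `A` keeps the side and forces `A = 0`, so
`Y` is free over `R ⧸ I`: items 3 and 5. Applying these two items to the summand `I` shows that it
is free over `R ⧸ J`. As `I` is identified with the maximal ideal of `R ⧸ J`, that ring is a
discrete valuation ring: items 4 and 6. -/

namespace FiberTor

/-! ### Dimension shifting for left derived functors. -/

section LeftDerived

open Limits

variable {C D : Type*} [Category* C] [Abelian C] [Category* D] [Abelian D]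

/-- The augmentation of a projective resolution in degree zero. -/
def augmentation {X : C} (Q : ProjectiveResolution X) : Q.complex.X 0 ⟶ X := Q.π.f 0

instance {X : C} (Q : ProjectiveResolution X) : Epi (augmentation Q) :=
  inferInstanceAs (Epi (Q.π.f 0))

theorem d_comp_augmentation {X : C} (Q : ProjectiveResolution X) :
    Q.complex.d 1 0 ≫ augmentation Q = 0 :=
  Q.complex_d_comp_π_f_zero

theorem d_comp_augmentation_comp {X Y : C} (Q : ProjectiveResolution X) (f : X ⟶ Y) :
    Q.complex.d 1 0 ≫ augmentation Q ≫ f = 0 := by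
  rw [← Category.assoc, d_comp_augmentation, zero_comp]

theorem exact_d_augmentation {X : C} (Q : ProjectiveResolution X) :
    (ShortComplex.mk (Q.complex.d 1 0) (augmentation Q) (d_comp_augmentation Q)).Exact :=
  Q.exact₀

/-- Splicing a projective resolution of the kernel of an epimorphism from a projective object
yields a projective resolution of its target. -/
noncomputable def spliceResolution (S : ShortComplex C) (hS : S.ShortExact) [Projective S.X₂]
    (Q : ProjectiveResolution S.X₁) : ProjectiveResolution S.X₃ where
  complex := Q.complex.augment (X := S.X₂) (augmentation Q ≫ S.f)
    (by rw [d_comp_augmentation_comp])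
  projective n := by
    cases n with
    | zero => exact inferInstanceAs (Projective S.X₂)
    | succ n => exact inferInstanceAs (Projective (Q.complex.X n))
  π := (ChainComplex.toSingle₀Equiv _ _).symm ⟨S.g, by
    change (augmentation Q ≫ S.f) ≫ S.g = 0
    rw [Category.assoc, S.zero, comp_zero]⟩
  quasiIso := ⟨fun n => by
    match n with
    | 0 =>
      rw [ChainComplex.quasiIsoAt₀_iff, ShortComplex.quasiIso_iff_of_zeros']
      · let S' : ShortComplex C := ShortComplex.mk (augmentation Q ≫ S.f) S.g
          (by rw [Category.assoc, S.zero, comp_zero])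
        -- Precomposing the first map with an epimorphism does not change its image, so exactness in
        -- the middle carries over from `S`.
        let α : S' ⟶ S := { τ₁ := augmentation Q, τ₂ := 𝟙 _, τ₃ := 𝟙 _ }
        have : Epi α.τ₁ := inferInstanceAs (Epi (augmentation Q))
        have : IsIso α.τ₂ := inferInstanceAs (IsIso (𝟙 _))
        have : Mono α.τ₃ := inferInstanceAs (Mono (𝟙 _))
        have hS' : S'.Exact := (ShortComplex.exact_iff_of_epi_of_isIso_of_mono α).2 hS.exact
        refine (ShortComplex.exact_and_epi_g_iff_of_iso (S₂ := S') ?_).2 ⟨hS', hS.epi_g⟩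
        refine ShortComplex.isoMk (Iso.refl _) (Iso.refl _) (Iso.refl _) ?_ ?_
        · exact (Category.id_comp _).trans (Category.comp_id _).symm
        · refine (Category.id_comp _).trans (Eq.trans ?_ (Category.comp_id _).symm)
          exact (ChainComplex.toSingle₀Equiv_symm_apply_f_zero
            (C := Q.complex.augment (augmentation Q ≫ S.f) _) S.g _).symm
      all_goals rfl
    | 1 =>
      rw [quasiIsoAt_iff_exactAt' _ _ (ChainComplex.exactAt_succ_single_obj _ _),
        HomologicalComplex.exactAt_iff' _ 2 1 0 (by simp) (by simp)]
      let S₁ : ShortComplex C := ShortComplex.mk (Q.complex.d 1 0) (augmentation Q ≫ S.f)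
        (by rw [d_comp_augmentation_comp])
      let S₂ : ShortComplex C := ShortComplex.mk (Q.complex.d 1 0) (augmentation Q)
        (d_comp_augmentation Q)
      let α : S₂ ⟶ S₁ := { τ₁ := 𝟙 _, τ₂ := 𝟙 _, τ₃ := S.f }
      have : Epi α.τ₁ := inferInstanceAs (Epi (𝟙 _))
      have : IsIso α.τ₂ := inferInstanceAs (IsIso (𝟙 _))
      have : Mono α.τ₃ := hS.mono_f
      exact (ShortComplex.exact_iff_of_epi_of_isIso_of_mono α).1 (exact_d_augmentation Q)
    | n + 2 =>
      rw [quasiIsoAt_iff_exactAt' _ _ (ChainComplex.exactAt_succ_single_obj _ _),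
        HomologicalComplex.exactAt_iff' _ (n + 3) (n + 2) (n + 1) (by simp) (by simp)]
      exact Q.exact_succ n⟩

variable [HasProjectiveResolutions C]

theorem isZero_leftDerived_iff_exactAt {X : C} (P : ProjectiveResolution X) (F : C ⥤ D)
    [F.Additive] (n : ℕ) : IsZero ((F.leftDerived n).obj X) ↔
      ((F.mapHomologicalComplex _).obj P.complex).ExactAt n := by
  rw [HomologicalComplex.exactAt_iff_isZero_homology]
  exact (P.isoLeftDerivedObj F n).isZero_iff

/-- In these degrees the spliced resolution of `S.X₃` is the resolution of `S.X₁` moved up by one.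
In degree 1 the spliced map itself appears, which is why that case is treated separately. -/
theorem isZero_leftDerived_succ_of_shortExact {S : ShortComplex C} (hS : S.ShortExact)
    [Projective S.X₂] (F : C ⥤ D) [F.Additive] (n : ℕ)
    (h : IsZero ((F.leftDerived (n + 2)).obj S.X₃)) :
    IsZero ((F.leftDerived (n + 1)).obj S.X₁) := by
  let Q := projectiveResolution S.X₁
  rw [isZero_leftDerived_iff_exactAt (spliceResolution S hS Q),
    HomologicalComplex.exactAt_iff' _ (n + 3) (n + 2) (n + 1) (by simp) (by simp)] at h
  rw [isZero_leftDerived_iff_exactAt Q,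
    HomologicalComplex.exactAt_iff' _ (n + 2) (n + 1) n (by simp) (by simp)]
  exact h

/-- An element of `F S.X₁` killed in `F S.X₂` lifts to `F Q₀`. By exactness the lift comes from `F
Q₁`, so it dies in `F S.X₁`. -/
theorem mono_map_of_isZero_leftDerived_one {S : ShortComplex C} (hS : S.ShortExact)
    [Projective S.X₂] (F : C ⥤ D) [F.Additive] [F.PreservesEpimorphisms]
    (h : IsZero ((F.leftDerived 1).obj S.X₃)) : Mono (F.map S.f) := by
  let Q := projectiveResolution S.X₁
  rw [isZero_leftDerived_iff_exactAt (spliceResolution S hS Q),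
    HomologicalComplex.exactAt_iff' _ 2 1 0 (by simp) (by simp)] at h
  have h' : (ShortComplex.mk (F.map (Q.complex.d 1 0)) (F.map (augmentation Q ≫ S.f))
    (by rw [← F.map_comp, d_comp_augmentation_comp, F.map_zero])).Exact := h
  let e : F.obj (Q.complex.X 0) ⟶ F.obj S.X₁ := F.map (augmentation Q)
  have he : Epi e := inferInstanceAs (Epi (F.map (augmentation Q)))
  have hde : F.map (Q.complex.d 1 0) ≫ e = 0 := by
    rw [← F.map_comp, d_comp_augmentation, F.map_zero]
  refine Preadditive.mono_of_cancel_zero _ fun {A} g hg => ?_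
  obtain ⟨A₁, a₁, ha₁, x, hx⟩ := surjective_up_to_refinements_of_epi e g
  obtain ⟨A₂, a₂, ha₂, y, hy⟩ := h'.exact_up_to_refinements x (by
    change x ≫ F.map (augmentation Q ≫ S.f) = 0
    have : F.map (augmentation Q ≫ S.f) = e ≫ F.map S.f := F.map_comp _ _
    rw [this, ← Category.assoc, ← hx, Category.assoc, hg, comp_zero])
  rw [← cancel_epi a₁, ← cancel_epi a₂, hx]
  have hy' : a₂ ≫ x = y ≫ F.map (Q.complex.d 1 0) := hy
  rw [← Category.assoc, hy', Category.assoc, hde]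
  simp

end LeftDerived

/-! ### Vanishing of Tor: retracts, degree zero, and first syzygies. -/

section Tor

open Limits TensorProduct

variable {R : Type u} [CommRing R]

theorem TorVanishes.of_retract {n : ℕ} {M N A : ModuleCat.{u} R} (h : TorVanishes n M N)
    (i : A →ₗ[R] N) (r : N →ₗ[R] A) (hri : ∀ a, r (i a) = a) : TorVanishes n M A := by
  have hid : ModuleCat.ofHom i ≫ ModuleCat.ofHom r = 𝟙 A := by
    ext a
    exact hri a
  rw [TorVanishes, IsZero.iff_id_eq_zero]
  rw [← CategoryTheory.Functor.map_id, ← hid, Functor.map_comp,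
    h.eq_zero_of_tgt (((Tor (ModuleCat.{u} R) n).obj M).map (ModuleCat.ofHom i)), zero_comp]

theorem subsingleton_tensorProduct_of_torVanishes_zero {M N : ModuleCat.{u} R}
    (h : TorVanishes 0 M N) : Subsingleton (M ⊗[R] N) := by
  have : PreservesFiniteColimits ((MonoidalCategory.tensoringLeft (ModuleCat.{u} R)).obj M) :=
    inferInstanceAs (PreservesFiniteColimits (MonoidalCategory.tensorLeft M))
  have h' := h.of_iso
    (((MonoidalCategory.tensoringLeft (ModuleCat.{u} R)).obj M).leftDerivedZeroIsoSelf.symm.app N)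
  exact ModuleCat.subsingleton_of_isZero h'

variable {F Y : Type u} [AddCommGroup F] [Module R F] [AddCommGroup Y] [Module R Y]
  [Module.Free R F] (p : F →ₗ[R] Y) (hp : Function.Surjective p)

include hp

theorem TorVanishes.ker {n : ℕ} {M : ModuleCat.{u} R}
    (h : TorVanishes (n + 2) M (ModuleCat.of R Y)) :
    TorVanishes (n + 1) M (ModuleCat.of R (LinearMap.ker p)) := by
  have : Projective p.shortComplexKer.X₂ := inferInstanceAs (Projective (ModuleCat.of R F))
  exact isZero_leftDerived_succ_of_shortExact (LinearMap.shortExact_shortComplexKer hp)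
    ((MonoidalCategory.tensoringLeft (ModuleCat.{u} R)).obj M) n h

theorem TorVanishes.lTensor_ker_injective {M : ModuleCat.{u} R}
    (h : TorVanishes 1 M (ModuleCat.of R Y)) :
    Function.Injective ((LinearMap.ker p).subtype.lTensor M) := by
  have : Projective p.shortComplexKer.X₂ := inferInstanceAs (Projective (ModuleCat.of R F))
  have : ((MonoidalCategory.tensoringLeft (ModuleCat.{u} R)).obj M).PreservesEpimorphisms :=
    Functor.preservesEpimorphisms_of_adjunction (ihom.adjunction M)
  have := mono_map_of_isZero_leftDerived_one (LinearMap.shortExact_shortComplexKer hp)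
    ((MonoidalCategory.tensoringLeft (ModuleCat.{u} R)).obj M) h
  exact (ModuleCat.mono_iff_injective _).1 this

end Tor

/-! ### Tensor products and minimal covers over local rings. -/

section Algebra

open TensorProduct

variable {R : Type u} [CommRing R]

/-- Nakayama's lemma reduces this to vector spaces over the residue field, where a tensor product of
nonzero spaces is nonzero. -/
theorem subsingleton_or_of_subsingleton_tensorProduct [IsLocalRing R] (M N : Type*)
    [AddCommGroup M] [Module R M] [Module.Finite R M]
    [AddCommGroup N] [Module R N] [Module.Finite R N] (h : Subsingleton (M ⊗[R] N)) :
    Subsingleton M ∨ Subsingleton N := by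
  let k := IsLocalRing.ResidueField R
  rw [← IsLocalRing.subsingleton_tensorProduct (R := R) (M := M),
    ← IsLocalRing.subsingleton_tensorProduct (R := R) (M := N)]
  have e : (k ⊗[R] M) ⊗[k] (k ⊗[R] N) ≃ₗ[k] k ⊗[R] (M ⊗[R] N) :=
    (TensorProduct.AlgebraTensorModule.distribBaseChange R k M N).symm
  have h2 : Subsingleton ((k ⊗[R] M) ⊗[k] (k ⊗[R] N)) := e.toEquiv.subsingleton
  by_contra! hc
  obtain ⟨h3, h4⟩ := hc
  exact not_nontrivial_iff_subsingleton.2 h2 inferInstance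

/-- Scalars from `I` move across the tensor sign and kill `M`, so the injective map `f.lTensor M` is
zero. -/
theorem subsingleton_tensorProduct_of_lTensor_injective {M N P : Type*} [AddCommGroup M]
    [Module R M] [AddCommGroup N] [Module R N] [AddCommGroup P] [Module R P] (f : N →ₗ[R] P)
    (hf : Function.Injective (f.lTensor M)) (I : Ideal R) (hM : ∀ r ∈ I, ∀ x : M, r • x = 0)
    (hI : ∀ x, f x ∈ I • (⊤ : Submodule R P)) : Subsingleton (M ⊗[R] N) := by
  refine subsingleton_of_forall_eq 0 fun t => hf ?_
  rw [map_zero]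
  induction t with
  | zero => simp
  | add x y hx hy => rw [map_add, hx, hy, add_zero]
  | tmul x y =>
    rw [LinearMap.lTensor_tmul]
    refine Submodule.smul_induction_on (p := fun z => x ⊗ₜ[R] z = 0) (hI y) ?_ ?_
    · intro r hr z _
      rw [← TensorProduct.smul_tmul, hM r hr, TensorProduct.zero_tmul]
    · intro a b ha hb
      rw [TensorProduct.tmul_add, ha, hb, add_zero]

/-- Lift a basis of `k ⊗ Y`: Nakayama gives surjectivity, and independence of the basis puts the
coefficients of every relation in the maximal ideal. -/
theorem exists_minimal_cover [IsLocalRing R] (Y : Type*) [AddCommGroup Y] [Module R Y]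
    [Module.Finite R Y] : ∃ (n : ℕ) (p : (Fin n → R) →ₗ[R] Y), Function.Surjective p ∧
      ∀ f, p f = 0 → ∀ i, f i ∈ IsLocalRing.maximalIdeal R := by
  classical
  let k := IsLocalRing.ResidueField R
  let b := Module.finBasis k (k ⊗[R] Y)
  choose v hv using fun i => TensorProduct.mk_surjective R Y k Ideal.Quotient.mk_surjective (b i)
  refine ⟨_, Fintype.linearCombination R v, ?_, fun f hf i => ?_⟩
  · rw [← LinearMap.range_eq_top, Fintype.range_linearCombination]
    exact IsLocalRing.span_eq_top_of_tmul_eq_basis v b hv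
  · have h : ∑ i, IsLocalRing.residue R (f i) • b i = 0 := by
      have := congrArg (TensorProduct.mk R k Y 1) hf
      rw [Fintype.linearCombination_apply, map_sum, map_zero] at this
      rw [← this]
      refine Finset.sum_congr rfl fun i _ => ?_
      rw [map_smul, hv]
      exact algebraMap_smul k (f i) (b i)
    exact (IsLocalRing.residue_eq_zero_iff _).1
      (Fintype.linearIndependent_iff.1 b.linearIndependent _ h i)

end Algebra

/-! ### Syzygies over a local ring with decomposable maximal ideal. -/

section Syzygy

open TensorProduct IsLocalRing

variable {R : Type u} [CommRing R]

/-- `Y` is isomorphic to a finite direct power of `R ⧸ I`. -/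
def IsFreeModulo (I : Ideal R) (Y : Type*) [AddCommGroup Y] [Module R Y] : Prop :=
  ∃ (n : ℕ) (p : (Fin n → R) →ₗ[R] Y), Function.Surjective p ∧ ∀ f, p f = 0 ↔ ∀ i, f i ∈ I

theorem isFreeModulo_of_subsingleton (I : Ideal R) (Y : Type*) [AddCommGroup Y] [Module R Y]
    [Subsingleton Y] : IsFreeModulo I Y :=
  ⟨0, 0, fun y => ⟨0, Subsingleton.elim _ _⟩, fun f => by simp⟩

theorem le_annihilator_of_inf_eq_bot {I J : Ideal R} (h : I ⊓ J = ⊥) :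
    J ≤ Module.annihilator R I := by
  intro r hr
  rw [Module.mem_annihilator]
  intro x
  have : r * x.1 ∈ I ⊓ J := ⟨I.mul_mem_left _ x.2, J.mul_mem_right _ hr⟩
  rw [h] at this
  exact Subtype.ext this

theorem mem_smul_top_of_forall_mem {n : ℕ} {I : Ideal R} {f : Fin n → R} (hf : ∀ i, f i ∈ I) :
    f ∈ I • (⊤ : Submodule R (Fin n → R)) := by
  rw [pi_eq_sum_univ f]
  exact Submodule.sum_mem _ fun i _ => Submodule.smul_mem_smul (hf i) trivial

variable [IsLocalRing R]

/-- Ideals that decompose the maximal ideal of a local ring as a direct sum of two nonzero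
ideals. -/
structure DecomposesMaximalIdeal (I J : Ideal R) : Prop where
  inf_eq_bot : I ⊓ J = ⊥
  sup_eq_maximalIdeal : I ⊔ J = maximalIdeal R
  left_ne_bot : I ≠ ⊥
  right_ne_bot : J ≠ ⊥

namespace DecomposesMaximalIdeal

theorem symm {I J : Ideal R} (h : DecomposesMaximalIdeal I J) : DecomposesMaximalIdeal J I :=
  ⟨inf_comm I J ▸ h.inf_eq_bot, sup_comm I J ▸ h.sup_eq_maximalIdeal, h.right_ne_bot,
    h.left_ne_bot⟩

theorem not_subsingleton_left {I J : Ideal R} (h : DecomposesMaximalIdeal I J) :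
    ¬ Subsingleton I := fun hI => h.left_ne_bot (Submodule.subsingleton_iff_eq_bot.1 hI)

end DecomposesMaximalIdeal

variable [IsNoetherianRing R]

/-- The first syzygy of a module annihilated by `I` splits off copies of `I`, the complement `A`
being annihilated by `I` as well. -/
theorem exists_syzygy {I J : Ideal R} (hbot : I ⊓ J = ⊥) (hsup : I ⊔ J = maximalIdeal R)
    (Y : ModuleCat.{u} R) [Module.Finite R Y] [Nontrivial Y] (hY : I ≤ Module.annihilator R Y) :
    ∃ A : ModuleCat.{u} R, Module.Finite R A ∧ I ≤ Module.annihilator R A ∧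
      (Subsingleton A → IsFreeModulo I Y) ∧
      (∀ n M, TorVanishes (n + 2) M Y → TorVanishes (n + 1) M A ∧
        TorVanishes (n + 1) M (ModuleCat.of R I)) ∧
      ∀ M : ModuleCat.{u} R, TorVanishes 1 M Y →
        (I ≤ Module.annihilator R M → Subsingleton (M ⊗[R] I)) ∧
        (J ≤ Module.annihilator R M → Subsingleton (M ⊗[R] A)) := by
  obtain ⟨n, p, hp, hmin⟩ := exists_minimal_cover (R := R) Y
  obtain ⟨i₀⟩ : Nonempty (Fin n) := by
    by_contra hn
    rw [not_nonempty_iff] at hn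
    exact not_subsingleton Y hp.subsingleton
  have hIp : ∀ f : Fin n → R, (∀ i, f i ∈ I) → f ∈ LinearMap.ker p := by
    intro f hf
    rw [LinearMap.mem_ker, pi_eq_sum_univ f, map_sum]
    refine Finset.sum_eq_zero fun i _ => ?_
    rw [map_smul]
    exact Module.mem_annihilator.1 (hY (hf i)) _
  -- `A` and `B` are the parts of the kernel with coordinates in `J` and in `I`. They are
  -- complementary because the cover is minimal and `I^n` lies in the kernel.
  let A : Submodule R (LinearMap.ker p) :=
    (Submodule.pi Set.univ fun _ => J).comap (LinearMap.ker p).subtype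
  let B : Submodule R (LinearMap.ker p) :=
    (Submodule.pi Set.univ fun _ => I).comap (LinearMap.ker p).subtype
  have hA : ∀ a : A, ∀ i, a.1.1 i ∈ J := fun a i => a.2 i trivial
  have hB : ∀ a : B, ∀ i, a.1.1 i ∈ I := fun a i => a.2 i trivial
  have hAB : IsCompl A B := by
    constructor
    · rw [Submodule.disjoint_def]
      intro x hxA hxB
      ext i
      have : x.1 i ∈ I ⊓ J := ⟨hB ⟨x, hxB⟩ i, hA ⟨x, hxA⟩ i⟩
      rwa [hbot] at this
    · rw [codisjoint_iff, eq_top_iff]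
      intro x _
      have hx := hmin x.1 x.2
      rw [← hsup] at hx
      choose b hb a ha hab using fun i => Submodule.mem_sup.1 (hx i)
      have hbx : b ∈ LinearMap.ker p := hIp b hb
      have hax : a ∈ LinearMap.ker p := by
        have : a = x.1 - b := by
          ext i
          simp [← hab i]
        rw [this]
        exact Submodule.sub_mem _ x.2 hbx
      refine Submodule.mem_sup.2 ⟨⟨a, hax⟩, fun i _ => ha i, ⟨b, hbx⟩, fun i _ => hb i, ?_⟩
      ext i
      simp [← hab i, add_comm]
  -- One copy of `I`, in coordinate `i₀`, suffices. It is a retract of `B`, hence of the kernel.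
  let iI : I →ₗ[R] LinearMap.ker p :=
    ((LinearMap.single R (fun _ : Fin n => R) i₀).comp I.subtype).codRestrict _ fun x => by
      refine hIp _ fun i => ?_
      by_cases h : i = i₀
      · subst h
        simp
      · simp [h]
  let rB : B →ₗ[R] I :=
    ((LinearMap.proj i₀).comp ((LinearMap.ker p).subtype.comp B.subtype)).codRestrict I
      fun x => hB x i₀
  let rI : LinearMap.ker p →ₗ[R] I := rB.comp (Submodule.projectionOnto B A hAB.symm)
  have hiIB : ∀ x, iI x ∈ B := by
    intro x i _
    by_cases h : i = i₀
    · subst h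
      simp [iI]
    · simp [iI, h]
  have hrI : ∀ x, rI (iI x) = x := by
    intro x
    have : Submodule.projectionOnto B A hAB.symm (iI x) = ⟨iI x, hiIB x⟩ :=
      Submodule.projectionOnto_apply_left hAB.symm ⟨iI x, hiIB x⟩
    change rB (Submodule.projectionOnto B A hAB.symm (iI x)) = x
    rw [this]
    exact Subtype.ext (Pi.single_eq_same (M := fun _ => R) i₀ x.1)
  have hrA : ∀ a : A, Submodule.projectionOnto A B hAB (A.subtype a) = a := fun a =>
    Submodule.projectionOnto_apply_left hAB a
  have hinj : ∀ {N : Type u} [AddCommGroup N] [Module R N] (M : ModuleCat.{u} R)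
      (i : N →ₗ[R] LinearMap.ker p) (r : LinearMap.ker p →ₗ[R] N), (∀ x, r (i x) = x) →
      TorVanishes 1 M Y → Function.Injective (((LinearMap.ker p).subtype.comp i).lTensor M) := by
    intro N _ _ M i r hri h
    rw [LinearMap.lTensor_comp]
    refine (TorVanishes.lTensor_ker_injective p hp h).comp
      (Function.LeftInverse.injective (g := r.lTensor M) fun t => ?_)
    rw [← LinearMap.comp_apply, ← LinearMap.lTensor_comp,
      show r.comp i = LinearMap.id from LinearMap.ext hri, LinearMap.lTensor_id,
      LinearMap.id_apply]
  refine ⟨ModuleCat.of R A, inferInstanceAs (Module.Finite R A), ?_, ?_, ?_, ?_⟩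
  · intro r hr
    rw [Module.mem_annihilator]
    intro a
    ext i
    have : r * a.1.1 i ∈ I ⊓ J := ⟨I.mul_mem_right _ hr, J.mul_mem_left _ (hA a i)⟩
    rw [hbot] at this
    exact this
  · intro hsub
    refine ⟨n, p, hp, fun f => ⟨fun hf => ?_, fun hf => hIp f hf⟩⟩
    have hsub' : Subsingleton A := hsub
    have hBtop : B = ⊤ := by
      rw [← hAB.sup_eq_top, (Submodule.subsingleton_iff_eq_bot).1 hsub', bot_sup_eq]
    exact hB ⟨⟨f, hf⟩, hBtop ▸ Submodule.mem_top⟩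
  · intro m M h
    have h' := TorVanishes.ker p hp h
    exact ⟨h'.of_retract (A := ModuleCat.of R A) A.subtype _ hrA,
      h'.of_retract (A := ModuleCat.of R I) iI rI hrI⟩
  · intro M h
    refine ⟨fun hM => ?_, fun hM => ?_⟩
    · refine subsingleton_tensorProduct_of_lTensor_injective _ (hinj M iI rI hrI h) I
        (fun r hr => Module.mem_annihilator.1 (hM hr)) fun x => ?_
      exact mem_smul_top_of_forall_mem (hB ⟨iI x, hiIB x⟩)
    · refine subsingleton_tensorProduct_of_lTensor_injective _ (hinj M A.subtype _ hrA h) J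
        (fun r hr => Module.mem_annihilator.1 (hM hr)) fun x => ?_
      exact mem_smul_top_of_forall_mem (hA x)

namespace DecomposesMaximalIdeal

/-- Both parities are proved together for all decompositions, since replacing the second module by
`I` exchanges `I` and `J`. The ideal `I` is nonzero, so the conclusion falls on the first module. -/
theorem subsingleton_or_of_tor (m : ℕ) : ∀ {I J : Ideal R}, DecomposesMaximalIdeal I J →
    ((∀ (M Z : ModuleCat.{u} R) [Module.Finite R M] [Module.Finite R Z],
      J ≤ Module.annihilator R M → I ≤ Module.annihilator R Z → TorVanishes (2 * m) M Z →
      Subsingleton M ∨ Subsingleton Z) ∧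
    (∀ (X Y : ModuleCat.{u} R) [Module.Finite R X] [Module.Finite R Y],
      I ≤ Module.annihilator R X → I ≤ Module.annihilator R Y → TorVanishes (2 * m + 1) X Y →
      Subsingleton X ∨ Subsingleton Y)) := by
  induction m with
  | zero =>
    refine fun {I J} hd => ⟨fun M Z _ _ _ _ h => ?_, fun X Y _ _ hX hY h => ?_⟩
    · exact subsingleton_or_of_subsingleton_tensorProduct M Z
        (subsingleton_tensorProduct_of_torVanishes_zero h)
    · rcases subsingleton_or_nontrivial Y with hY' | hY'
      · exact .inr hY'
      obtain ⟨A, -, -, -, -, h1⟩ := exists_syzygy hd.inf_eq_bot hd.sup_eq_maximalIdeal Y hY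
      exact .inl ((subsingleton_or_of_subsingleton_tensorProduct X I
        ((h1 X h).1 hX)).resolve_right hd.not_subsingleton_left)
  | succ m ih =>
    -- The even case in degree `2 * (m + 1)` rests on the odd case one degree lower. It is isolated
    -- because the next odd degree uses it with the ideals exchanged.
    have key : ∀ {I J : Ideal R}, DecomposesMaximalIdeal I J →
        ∀ (M Z : ModuleCat.{u} R) [Module.Finite R M] [Module.Finite R Z],
        J ≤ Module.annihilator R M → I ≤ Module.annihilator R Z →
        TorVanishes (2 * (m + 1)) M Z → Subsingleton M ∨ Subsingleton Z := by
      intro I J hd M Z _ _ hM hZ h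
      rcases subsingleton_or_nontrivial Z with hZ' | hZ'
      · exact .inr hZ'
      obtain ⟨A, -, -, -, hshift, -⟩ :=
        exists_syzygy hd.inf_eq_bot hd.sup_eq_maximalIdeal Z hZ
      have : Module.Finite R (ModuleCat.of R I) := inferInstanceAs (Module.Finite R I)
      exact .inl (((ih hd.symm).2 M (ModuleCat.of R I) hM
        (le_annihilator_of_inf_eq_bot hd.inf_eq_bot) (hshift (2 * m) M h).2).resolve_right
          hd.not_subsingleton_left)
    refine fun {I J} hd => ⟨key hd, fun X Y _ _ hX hY h => ?_⟩
    rcases subsingleton_or_nontrivial Y with hY' | hY'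
    · exact .inr hY'
    obtain ⟨A, -, -, -, hshift, -⟩ := exists_syzygy hd.inf_eq_bot hd.sup_eq_maximalIdeal Y hY
    have : Module.Finite R (ModuleCat.of R I) := inferInstanceAs (Module.Finite R I)
    exact .inl ((key hd.symm X (ModuleCat.of R I) hX
        (le_annihilator_of_inf_eq_bot hd.inf_eq_bot) (hshift (2 * m + 1) X h).2).resolve_right
          hd.not_subsingleton_left)

variable {I J : Ideal R} (hd : DecomposesMaximalIdeal I J)
include hd

theorem isFreeModulo_of_tor_even (X Y : ModuleCat.{u} R) [Module.Finite R X] [Module.Finite R Y]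
    (hX : I ≤ Module.annihilator R X) (hY : I ≤ Module.annihilator R Y) [Nontrivial X] (m : ℕ)
    (h : TorVanishes (2 * m) X Y) : IsFreeModulo I Y := by
  rcases subsingleton_or_nontrivial Y with hY' | hY'
  · exact isFreeModulo_of_subsingleton I Y
  cases m with
  | zero =>
    exact absurd (subsingleton_or_of_subsingleton_tensorProduct X Y
        (subsingleton_tensorProduct_of_torVanishes_zero h)) (by
      simpa [not_or] using ⟨not_subsingleton X, not_subsingleton Y⟩)
  | succ m =>
    obtain ⟨A, _, hA, hfree, hshift, -⟩ :=
      exists_syzygy hd.inf_eq_bot hd.sup_eq_maximalIdeal Y hY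
    exact hfree (((hd.subsingleton_or_of_tor m).2 X A hX hA (hshift (2 * m) X h).1).resolve_left
      (not_subsingleton X))

theorem isFreeModulo_of_tor_odd (M Z : ModuleCat.{u} R) [Module.Finite R M] [Module.Finite R Z]
    (hM : J ≤ Module.annihilator R M) (hZ : I ≤ Module.annihilator R Z) [Nontrivial M] (m : ℕ)
    (h : TorVanishes (2 * m + 1) M Z) : IsFreeModulo I Z := by
  rcases subsingleton_or_nontrivial Z with hZ' | hZ'
  · exact isFreeModulo_of_subsingleton I Z
  obtain ⟨A, _, hA, hfree, hshift, hone⟩ :=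
    exists_syzygy hd.inf_eq_bot hd.sup_eq_maximalIdeal Z hZ
  refine hfree (Or.resolve_left ?_ (not_subsingleton M))
  cases m with
  -- In degree 1 no shift is available. Instead `A ⊆ J^n` and `J` kills `M`, so `M ⊗ A = 0`.
  | zero => exact subsingleton_or_of_subsingleton_tensorProduct M A ((hone M h).2 hM)
  | succ m => exact (hd.subsingleton_or_of_tor (m + 1)).1 M A hM hA (hshift (2 * m + 1) M h).1

theorem isFreeModulo_left_of_tor_even (X Y : ModuleCat.{u} R) [Module.Finite R X]
    [Module.Finite R Y] (hX : I ≤ Module.annihilator R X) (hY : I ≤ Module.annihilator R Y)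
    [Nontrivial X] [Nontrivial Y] (m : ℕ) (h : TorVanishes (2 * m) X Y) : IsFreeModulo J I := by
  cases m with
  | zero =>
    exact absurd (subsingleton_or_of_subsingleton_tensorProduct X Y
        (subsingleton_tensorProduct_of_torVanishes_zero h)) (by
      simpa [not_or] using ⟨not_subsingleton X, not_subsingleton Y⟩)
  | succ m =>
    obtain ⟨A, -, -, -, hshift, -⟩ :=
      exists_syzygy hd.inf_eq_bot hd.sup_eq_maximalIdeal Y hY
    have : Module.Finite R (ModuleCat.of R I) := inferInstanceAs (Module.Finite R I)
    exact hd.symm.isFreeModulo_of_tor_odd X (ModuleCat.of R I) hX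
      (le_annihilator_of_inf_eq_bot hd.inf_eq_bot) m (hshift (2 * m) X h).2

/-- The shift to `Tor_{2m}(M, I)` needs starting degree at least 2, hence `0 < m`. -/
theorem isFreeModulo_left_of_tor_odd (M Z : ModuleCat.{u} R) [Module.Finite R M]
    [Module.Finite R Z] (hM : J ≤ Module.annihilator R M) (hZ : I ≤ Module.annihilator R Z)
    [Nontrivial M] [Nontrivial Z] (m : ℕ) (hm : 0 < m) (h : TorVanishes (2 * m + 1) M Z) :
    IsFreeModulo J I := by
  obtain ⟨m, rfl⟩ := Nat.exists_eq_succ_of_ne_zero hm.ne'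
  obtain ⟨A, -, -, -, hshift, -⟩ :=
    exists_syzygy hd.inf_eq_bot hd.sup_eq_maximalIdeal Z hZ
  have : Module.Finite R (ModuleCat.of R I) := inferInstanceAs (Module.Finite R I)
  exact hd.symm.isFreeModulo_of_tor_even M (ModuleCat.of R I) hM
    (le_annihilator_of_inf_eq_bot hd.inf_eq_bot) (m + 1) (hshift (2 * m + 1) M h).2

end DecomposesMaximalIdeal

end Syzygy

/-! ### A criterion for discrete valuation rings. -/

section DVR

open IsLocalRing

/-- By Krull's intersection theorem every nonzero element is a power of `t` times a unit. As `t` is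
regular, the ring is a domain. -/
theorem isDVR_of_maximalIdeal_eq_span_singleton {S : Type u} [CommRing S] [IsLocalRing S]
    [IsNoetherianRing S] (t : S) (ht : maximalIdeal S = Ideal.span {t})
    (hreg : ∀ x, x * t = 0 → x = 0) : IsDVR S := by
  have hpow : ∀ n x, t ^ n * x = 0 → x = 0 := by
    intro n
    induction n with
    | zero => simp
    | succ n ih => exact fun x hx => ih _ (hreg _ (by rw [← hx]; ring))
  have hfactor : ∀ x : S, x ≠ 0 → ∃ n u, IsUnit u ∧ x = t ^ n * u := by
    intro x hx
    have hfin : FiniteMultiplicity t x := by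
      by_contra hinf
      rw [FiniteMultiplicity.not_iff_forall] at hinf
      refine hx ?_
      have : x ∈ ⨅ n, maximalIdeal S ^ n := by
        rw [Ideal.mem_iInf]
        intro n
        rw [ht, Ideal.span_singleton_pow, Ideal.mem_span_singleton]
        exact hinf n
      rwa [Ideal.iInf_pow_eq_bot_of_isLocalRing _ (maximalIdeal.isMaximal S).ne_top] at this
    obtain ⟨u, hu, hdvd⟩ := hfin.exists_eq_pow_mul_and_not_dvd
    refine ⟨_, u, ?_, hu⟩
    by_contra hunit
    rw [← Ideal.mem_span_singleton, ← ht] at hdvd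
    exact hdvd hunit
  have : NoZeroDivisors S := by
    refine ⟨fun {x y} hxy => ?_⟩
    by_contra! hne
    obtain ⟨n, w, hw, rfl⟩ := hfactor x hne.1
    refine hne.2 (hpow n y (hw.mul_left_cancel ?_))
    rw [mul_zero, ← hxy]
    ring
  have hdom : IsDomain S := NoZeroDivisors.to_isDomain S
  have hfield : ¬ IsField S := by
    rw [isField_iff_maximalIdeal_eq, ht, Ideal.span_singleton_eq_bot]
    rintro rfl
    exact one_ne_zero (hreg 1 (mul_zero 1))
  exact ⟨hdom, ((IsDiscreteValuationRing.TFAE S hfield).out 0 4).2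
    (⟨t, ht⟩ : (maximalIdeal S).IsPrincipal)⟩

end DVR

/-! ### From modules over `R` to modules over its quotients. -/

section Transfer

open IsLocalRing

variable {R S : Type u} [CommRing R] [CommRing S] (φ : R →+* S) (hφ : Function.Surjective φ)
include hφ

theorem IsFreeModulo.free {Y : Type*} [AddCommGroup Y] [Module R Y] [Module S Y]
    (hsmul : ∀ (r : R) (y : Y), r • y = φ r • y) (h : IsFreeModulo (RingHom.ker φ) Y) :
    Module.Free S Y := by
  classical
  obtain ⟨n, p, hp, hker⟩ := h
  let v : Fin n → Y := fun i => p (Pi.single i 1)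
  have hpv : ∀ f, p f = ∑ i, φ (f i) • v i := by
    intro f
    conv_lhs => rw [pi_eq_sum_univ' f]
    simp [map_sum, map_smul, hsmul, v]
  refine Module.Free.of_basis (Module.Basis.mk (v := v) (R := S) ?_ ?_)
  · rw [Fintype.linearIndependent_iff]
    intro g hg i
    choose f hf using fun i => hφ (g i)
    rw [← hf i]
    exact (hker f).1 (by rw [hpv]; simpa only [hf] using hg) i
  · rintro y -
    obtain ⟨f, rfl⟩ := hp y
    rw [hpv]
    exact Submodule.sum_mem _ fun i _ => Submodule.smul_mem _ _ (Submodule.subset_span ⟨i, rfl⟩)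

theorem IsFreeModulo.isDVR [IsLocalRing R] [IsLocalRing S] [IsNoetherianRing S] {I : Ideal R}
    (hd : DecomposesMaximalIdeal I (RingHom.ker φ)) (h : IsFreeModulo (RingHom.ker φ) I) :
    IsDVR S := by
  classical
  obtain ⟨n, p, hp, hker⟩ := h
  have hcancel : ∀ x ∈ I, φ x = 0 → x = 0 := by
    intro x hx hx'
    have : x ∈ I ⊓ RingHom.ker φ := ⟨hx, hx'⟩
    rwa [hd.inf_eq_bot] at this
  have hn : ∀ i j : Fin n, i = j := by
    intro i j
    by_contra hij
    let a : Fin n → I := fun i => p (Pi.single i 1)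
    -- Elements of an ideal satisfy the commutation relation `a_j a_i - a_i a_j = 0`. Freeness puts
    -- its coefficients in the kernel of `φ`, which meets `I` trivially, so a basis has at most one
    -- element.
    have h0 : p ((a j).1 • Pi.single i 1 - (a i).1 • Pi.single j 1) = 0 := by
      rw [map_sub, map_smul, map_smul, sub_eq_zero]
      exact Subtype.ext (mul_comm _ _)
    have h1 : (a j).1 ∈ RingHom.ker φ := by
      simpa [hij] using (hker _).1 h0 i
    have h2 : a j = 0 := Subtype.ext (hcancel _ (a j).2 h1)
    have h3 := (hker _).1 h2 j
    rw [Pi.single_eq_same, RingHom.mem_ker, map_one] at h3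
    exact one_ne_zero h3
  obtain ⟨i₀⟩ : Nonempty (Fin n) := by
    by_contra hempty
    rw [not_nonempty_iff] at hempty
    exact hd.not_subsingleton_left hp.subsingleton
  let t : I := p (Pi.single i₀ 1)
  have hpt : ∀ f, p f = f i₀ • t := by
    intro f
    have : f = f i₀ • Pi.single i₀ 1 := by
      ext i
      simp [hn i i₀]
    conv_lhs => rw [this]
    rw [map_smul]
  have hloc : IsLocalHom φ := IsLocalHom.of_surjective φ hφ
  -- The image of `I` is the whole maximal ideal of `S`, as the other summand is killed by `φ`.
  -- Freeness on `t` makes `φ t` regular.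
  refine isDVR_of_maximalIdeal_eq_span_singleton (φ t) ?_ ?_
  · apply le_antisymm
    · intro s hs
      obtain ⟨r, rfl⟩ := hφ s
      have hr : r ∈ maximalIdeal R := fun hu => hs (hu.map φ)
      rw [← hd.sup_eq_maximalIdeal] at hr
      obtain ⟨x, hx, y, hy, rfl⟩ := Submodule.mem_sup.1 hr
      obtain ⟨f, hf⟩ := hp ⟨x, hx⟩
      rw [hpt] at hf
      have hx' : f i₀ * t.1 = x := congrArg Subtype.val hf
      rw [map_add, (RingHom.mem_ker).1 hy, add_zero, ← hx', map_mul]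
      exact Ideal.mul_mem_left _ _ (Ideal.mem_span_singleton_self _)
    · rw [Ideal.span_singleton_le_iff_mem]
      have : t.1 ∈ maximalIdeal R := hd.sup_eq_maximalIdeal ▸ Submodule.mem_sup_left t.2
      exact fun hu => this (isUnit_of_map_unit φ _ hu)
  · intro s hs
    obtain ⟨r, rfl⟩ := hφ s
    rw [← map_mul] at hs
    have h0 : p (Pi.single i₀ r) = 0 := by
      rw [hpt, Pi.single_eq_same]
      exact Subtype.ext (hcancel _ (I.mul_mem_left r t.2) hs)
    simpa using (hker _).1 h0 i₀

theorem finite_restrictScalars (X : ModuleCat.{u} S) [Module.Finite S X] :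
    Module.Finite R ((ModuleCat.restrictScalars φ).obj X) := by
  let _ : Algebra R S := φ.toAlgebra
  let _ : Module R X := Module.compHom X φ
  have : IsScalarTower R S X := ⟨fun r s x => mul_smul (φ r) s x⟩
  have : Module.Finite R S := Module.Finite.of_surjective (Algebra.linearMap R S) hφ
  exact (Module.Finite.trans S X : Module.Finite R X)

omit hφ in
theorem ker_le_annihilator_restrictScalars (X : ModuleCat.{u} S) :
    RingHom.ker φ ≤ Module.annihilator R ((ModuleCat.restrictScalars φ).obj X) := by
  intro r hr
  rw [Module.mem_annihilator]
  intro x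
  rw [ModuleCat.restrictScalars.smul_def, (RingHom.mem_ker).1 hr]
  exact zero_smul S (x : X)

end Transfer

/-! ### The six statements for a pair of surjections. -/

section Main

open IsLocalRing

variable {R S T : Type u} [CommRing R] [CommRing S] [CommRing T] [IsLocalRing R]
  [IsNoetherianRing R] [IsLocalRing S] [IsNoetherianRing S] [IsLocalRing T] [IsNoetherianRing T]

/-- Rigidity of `Tor` over a Noetherian local ring `R` whose maximal ideal is the direct sum of the
kernels of the surjections `φ : R → S` and `ψ : R → T`. -/
theorem tor_rigidity (φ : R →+* S) (ψ : R →+* T) (hφ : Function.Surjective φ)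
    (hψ : Function.Surjective ψ) (hd : DecomposesMaximalIdeal (RingHom.ker ψ) (RingHom.ker φ))
    (X Y : ModuleCat.{u} S) (Z : ModuleCat.{u} T) [Module.Finite S X] [Module.Finite S Y]
    [Module.Finite T Z] (m : ℕ) :
    let resX := (ModuleCat.restrictScalars φ).obj X
    let resY := (ModuleCat.restrictScalars φ).obj Y
    let resZ := (ModuleCat.restrictScalars ψ).obj Z
    (TorVanishes (2 * m + 1) resX resY → Subsingleton X ∨ Subsingleton Y) ∧
    (TorVanishes (2 * m) resY resZ → Subsingleton Y ∨ Subsingleton Z) ∧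
    (TorVanishes (2 * m) resX resY → Nontrivial X → Module.Free S Y) ∧
    (¬ IsDVR T → TorVanishes (2 * m) resX resY → Subsingleton X ∨ Subsingleton Y) ∧
    (TorVanishes (2 * m + 1) resY resZ → Nontrivial Y → Module.Free T Z) ∧
    (¬ IsDVR S → 0 < m → TorVanishes (2 * m + 1) resY resZ → Subsingleton Y ∨ Subsingleton Z) := by
  intro resX resY resZ
  have : Module.Finite R resX := finite_restrictScalars φ hφ X
  have : Module.Finite R resY := finite_restrictScalars φ hφ Y
  have : Module.Finite R resZ := finite_restrictScalars ψ hψ Z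
  have hX : RingHom.ker φ ≤ Module.annihilator R resX := ker_le_annihilator_restrictScalars φ X
  have hY : RingHom.ker φ ≤ Module.annihilator R resY := ker_le_annihilator_restrictScalars φ Y
  have hZ : RingHom.ker ψ ≤ Module.annihilator R resZ := ker_le_annihilator_restrictScalars ψ Z
  refine ⟨fun h => (hd.symm.subsingleton_or_of_tor m).2 resX resY hX hY h,
    fun h => (hd.subsingleton_or_of_tor m).1 resY resZ hY hZ h, fun h hX' => ?_,
    fun hT h => ?_, fun h hY' => ?_, fun hS hm h => ?_⟩
  · have : Nontrivial resX := hX'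
    exact @IsFreeModulo.free _ _ _ _ φ hφ Y _ resY.isModule _ (fun _ _ => rfl)
      (hd.symm.isFreeModulo_of_tor_even resX resY hX hY m h)
  · by_contra! hne
    have : Nontrivial resX := hne.1
    have : Nontrivial resY := hne.2
    exact hT (IsFreeModulo.isDVR ψ hψ hd.symm
      (hd.symm.isFreeModulo_left_of_tor_even resX resY hX hY m h))
  · have : Nontrivial resY := hY'
    exact @IsFreeModulo.free _ _ _ _ ψ hψ Z _ resZ.isModule _ (fun _ _ => rfl)
      (hd.isFreeModulo_of_tor_odd resY resZ hY hZ m h)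
  · by_contra! hne
    have : Nontrivial resY := hne.1
    have : Nontrivial resZ := hne.2
    exact hS (IsFreeModulo.isDVR φ hφ hd
      (hd.isFreeModulo_left_of_tor_odd resY resZ hY hZ m hm h))

end Main

/-! ### The fiber product is Noetherian local with decomposable maximal ideal. -/

section FiberProduct

open IsLocalRing

theorem isNoetherian_of_surjective_algebraMap (R S : Type*) [CommRing R] [CommRing S] [Algebra R S]
    [IsNoetherianRing S] (h : Function.Surjective (algebraMap R S)) : IsNoetherian R S := by
  refine ⟨fun N => ?_⟩
  let N' : Ideal S :=
    { N with
      smul_mem' := fun s x hx => by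
        obtain ⟨r, rfl⟩ := h s
        rw [algebraMap_smul]
        exact N.smul_mem r hx }
  exact Submodule.FG.restrictScalars_of_surjective (S := N') (IsNoetherian.noetherian N') h

variable {S T : Type u} {k : Type v} [CommRing S] [CommRing T] [Field k] (πS : S →+* k)
  (πT : T →+* k) (hπS : Function.Surjective πS)
  (hπT : Function.Surjective πT)

include hπT in
theorem isLocalRing_fiberProduct [IsLocalRing S] [IsLocalRing T] :
    IsLocalRing (fiberProduct πS πT) := by
  have : IsLocalHom πT := IsLocalHom.of_surjective πT hπT
  exact RingHom.isLocalRing_pullback πS πT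

include hπS hπT in
-- The fiber product embeds in `S × T`, a Noetherian module over it because both projections are
-- surjective.
theorem isNoetherianRing_fiberProduct [IsNoetherianRing S] [IsNoetherianRing T] :
    IsNoetherianRing (fiberProduct πS πT) := by
  let _ : Algebra (fiberProduct πS πT) S := (etaS πS πT).toAlgebra
  let _ : Algebra (fiberProduct πS πT) T := (etaT πS πT).toAlgebra
  have := isNoetherian_of_surjective_algebraMap (fiberProduct πS πT) S
    (RingHom.surjective_pullbackFst_of_surjective πS πT hπT)
  have := isNoetherian_of_surjective_algebraMap (fiberProduct πS πT) T
    (RingHom.surjective_pullbackSnd_of_surjective πS πT hπS)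
  let f : fiberProduct πS πT →ₗ[fiberProduct πS πT] S × T :=
    (Algebra.linearMap _ S).prod (Algebra.linearMap _ T)
  exact isNoetherian_of_injective f Subtype.val_injective

include hπS hπT in
theorem decomposesMaximalIdeal_fiberProduct [IsLocalRing S] [IsLocalRing T]
    [IsLocalRing (fiberProduct πS πT)]
    (hS : ¬ IsField S) (hT : ¬ IsField T) :
    DecomposesMaximalIdeal (RingHom.ker (etaT πS πT)) (RingHom.ker (etaS πS πT)) where
  inf_eq_bot := by
    rw [eq_bot_iff]
    rintro ⟨⟨s, t⟩, h⟩ ⟨ht, hs⟩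
    exact Subtype.ext (Prod.ext hs ht)
  sup_eq_maximalIdeal := by
    have hlocT : IsLocalHom πT := IsLocalHom.of_surjective πT hπT
    have : IsLocalHom (etaS πS πT) := RingHom.isLocalHom_pullbackFst πS πT
    apply le_antisymm
    · exact sup_le (le_maximalIdeal (RingHom.ker_ne_top _)) (le_maximalIdeal (RingHom.ker_ne_top _))
    · rintro ⟨⟨s, t⟩, h⟩ hst
      let x : fiberProduct πS πT := ⟨⟨s, t⟩, h⟩
      have hs : s ∈ maximalIdeal S := fun hu =>
        hst (isUnit_of_map_unit (etaS πS πT) x hu)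
      rw [← ker_eq_maximalIdeal πS hπS, RingHom.mem_ker] at hs
      have ht : πT t = 0 := Eq.trans (Eq.symm h) hs
      refine Submodule.mem_sup.2 ⟨⟨⟨s, 0⟩, hs.trans (map_zero πT).symm⟩, rfl,
        ⟨⟨0, t⟩, (map_zero πS).trans ht.symm⟩, rfl, ?_⟩
      exact Subtype.ext (Prod.ext (add_zero s) (zero_add t))
  left_ne_bot hbot := by
    rw [isField_iff_maximalIdeal_eq, eq_bot_iff, ← ker_eq_maximalIdeal πS hπS] at hS
    refine hS fun s hs => ?_
    have : (⟨⟨s, 0⟩, hs.trans (map_zero πT).symm⟩ : fiberProduct πS πT) ∈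
      RingHom.ker (etaT πS πT) := rfl
    rw [hbot] at this
    exact congrArg (fun x => x.1.1) this
  right_ne_bot hbot := by
    rw [isField_iff_maximalIdeal_eq, eq_bot_iff, ← ker_eq_maximalIdeal πT hπT] at hT
    refine hT fun t ht => ?_
    have : (⟨⟨0, t⟩, (map_zero πS).trans (Eq.symm ht)⟩ : fiberProduct πS πT) ∈
      RingHom.ker (etaS πS πT) := rfl
    rw [hbot] at this
    exact congrArg (fun x => x.1.2) this

end FiberProduct

end FiberTor

open FiberTor in
theorem theorem1p5 {S T : Type u} {k : Type v} [CommRing S] [CommRing T] [Field k]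
    [IsLocalRing S] [IsNoetherianRing S] [IsLocalRing T] [IsNoetherianRing T]
    (πS : S →+* k) (πT : T →+* k)
    (hπS : Function.Surjective πS) (hπT : Function.Surjective πT)
    (hS : ¬ IsField S) (hT : ¬ IsField T) :
    (∀ (X Y Z : Type u) [AddCommGroup X] [Module S X] [Module.Finite S X]
        [AddCommGroup Y] [Module S Y] [Module.Finite S Y]
        [AddCommGroup Z] [Module T Z] [Module.Finite T Z] (m : ℕ),
      (TorVanishes (2 * m + 1) (ofS πS πT X) (ofS πS πT Y) → Subsingleton X ∨ Subsingleton Y) ∧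
      (TorVanishes (2 * m) (ofS πS πT Y) (ofT πS πT Z) → Subsingleton Y ∨ Subsingleton Z) ∧
      (TorVanishes (2 * m) (ofS πS πT X) (ofS πS πT Y) → Nontrivial X → Module.Free S Y) ∧
      (¬ IsDVR T → TorVanishes (2 * m) (ofS πS πT X) (ofS πS πT Y) →
        Subsingleton X ∨ Subsingleton Y) ∧
      (TorVanishes (2 * m + 1) (ofS πS πT Y) (ofT πS πT Z) → Nontrivial Y → Module.Free T Z) ∧
      (¬ IsDVR S → 0 < m → TorVanishes (2 * m + 1) (ofS πS πT Y) (ofT πS πT Z) →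
        Subsingleton Y ∨ Subsingleton Z)) ∧
    (∀ (X Y Z : Type u) [AddCommGroup X] [Module T X] [Module.Finite T X]
        [AddCommGroup Y] [Module T Y] [Module.Finite T Y]
        [AddCommGroup Z] [Module S Z] [Module.Finite S Z] (m : ℕ),
      (TorVanishes (2 * m + 1) (ofT πS πT X) (ofT πS πT Y) → Subsingleton X ∨ Subsingleton Y) ∧
      (TorVanishes (2 * m) (ofT πS πT Y) (ofS πS πT Z) → Subsingleton Y ∨ Subsingleton Z) ∧
      (TorVanishes (2 * m) (ofT πS πT X) (ofT πS πT Y) → Nontrivial X → Module.Free T Y) ∧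
      (¬ IsDVR S → TorVanishes (2 * m) (ofT πS πT X) (ofT πS πT Y) →
        Subsingleton X ∨ Subsingleton Y) ∧
      (TorVanishes (2 * m + 1) (ofT πS πT Y) (ofS πS πT Z) → Nontrivial Y → Module.Free S Z) ∧
      (¬ IsDVR T → 0 < m → TorVanishes (2 * m + 1) (ofT πS πT Y) (ofS πS πT Z) →
        Subsingleton Y ∨ Subsingleton Z)) := by
  have := isLocalRing_fiberProduct πS πT hπT
  have := isNoetherianRing_fiberProduct πS πT hπS hπT
  have hd := decomposesMaximalIdeal_fiberProduct πS πT hπS hπT hS hT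
  have hφ := RingHom.surjective_pullbackFst_of_surjective πS πT hπT
  have hψ := RingHom.surjective_pullbackSnd_of_surjective πS πT hπS
  refine ⟨fun X Y Z _ _ _ _ _ _ _ _ _ m => ?_, fun X Y Z _ _ _ _ _ _ _ _ _ m => ?_⟩
  · exact tor_rigidity (etaS πS πT) (etaT πS πT) hφ hψ hd (ModuleCat.of S X) (ModuleCat.of S Y)
      (ModuleCat.of T Z) m
  · exact tor_rigidity (etaT πS πT) (etaS πS πT) hψ hφ hd.symm (ModuleCat.of T X)
      (ModuleCat.of T Y) (ModuleCat.of S Z) m
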